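/- There are $n\ge 1$ boxes; box $i$ contains a value $v_i\ge 0$, drawn independently from a distribution $F_i$ on $[0,\infty)$. The values are revealed one at a time in an order $\pi$ (the $i$-th arriving box is $\pi(i)$), and an online algorithm must decide immediately and irrevocably whether to accept the revealed value; at most one value is accepted. A deterministic identity-blind algorithm $\mathsf{ALG}$ knows $\mathbf F=(F_1,\dots,F_n)$, but neither the order $\pi$ nor the identities of the arriving boxes: its decision at each step is a (measurable) function of $\mathbf F$ and of the values observed so far. Let $\mathsf{ALG}(\mathbf F,\pi)$ be the probability that $\mathsf{ALG}$ accepts a value equal to $\max_i v_i$, and let $\mathsf{OPT}_\pi(\mathbf F,\pi)$ be the largest such probability over all online algorithms that know both $\mathbf F$ and $\pi$. For $\varepsilon>0$ let $$\Gamma_\varepsilon(\mathsf{ALG})=\inf_{\mathbf F}\min_\pi \frac{\mathsf{ALG}(\mathbf F,\pi)}{\mathsf{OPT}_\pi(\mathbf F,\pi)},$$ where the infimum is over all $n\ge 1$ and all $\mathbf F=(F_1,\dots,F_n)$ such that $\Pr[\max_i v_i=x]\le\varepsilon$ for every $x\ge 0$ (no large point masses of the maximum). Theorem. There is exactly one $\lambda\in(0,1)$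 with $$\min_{\rho\ge\lambda}\frac{\lambda\ln(1/\rho)+\rho-\lambda}{\lambda+1-\lambda/\rho}=\frac{\lambda\ln(1/\lambda)}{\lambda+1/e}$$ (the minimum being attained). For this $\lambda$ put $\Gamma^*=\frac{\lambda\ln(1/\lambda)}{\lambda+1/e}$. Then $|\lambda-0.245|<0.0005$, $|\Gamma^*-0.562|<0.0005$, and every deterministic identity-blind algorithm $\mathsf{ALG}$ satisfies $\Gamma_\varepsilon(\mathsf{ALG})\le\Gamma^*$ for every $\varepsilon>0$. -/

import Mathlib

open MeasureTheory Set
open scoped NNReal ENNReal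

namespace IdentityBlind

/-- A deterministic online decision rule for `n` values arriving one after the other.
`acc i` is the set of observed prefixes `(v 0, …, v i)` at which the rule is willing to accept
the value that arrives at time `i`. -/
structure OnlineRule (n : ℕ) where
  acc : (i : Fin n) → Set (Iic i → ℝ≥0)
  measurable_acc : ∀ i, MeasurableSet (acc i)

/-- On the arriving values `v`, the rule is willing to accept the value at time `i`. -/
def OnlineRule.Wants {n : ℕ} (R : OnlineRule n) (v : Fin n → ℝ≥0) (i : Fin n) : Prop :=
  (fun j : Iic i => v j) ∈ R.acc i

/-- On the arriving values `v`, the rule accepts the value at time `i`: this is the first time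
at which it is willing to accept. -/
def OnlineRule.Accepts {n : ℕ} (R : OnlineRule n) (v : Fin n → ℝ≥0) (i : Fin n) : Prop :=
  R.Wants v i ∧ ∀ j, j < i → ¬ R.Wants v j

/-- The law `F (π 0) × ⋯ × F (π (n-1))` of the values in their order of arrival, when the box
arriving at time `i` is the box `π i`. -/
noncomputable def arrivalLaw {n : ℕ} (F : Fin n → ProbabilityMeasure ℝ≥0)
    (π : Equiv.Perm (Fin n)) : Measure (Fin n → ℝ≥0) :=
  Measure.pi fun i => (F (π i) : Measure ℝ≥0)

/-- The probability that the rule accepts a value and that this value is the maximum. -/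
noncomputable def OnlineRule.winProb {n : ℕ} (R : OnlineRule n)
    (F : Fin n → ProbabilityMeasure ℝ≥0) (π : Equiv.Perm (Fin n)) : ℝ≥0∞ :=
  arrivalLaw F π {v | ∃ i, R.Accepts v i ∧ v i = Finset.univ.sup v}

/-- The performance of the best order-aware online algorithm: the distributions `F` and the
arrival order `π` are known, so any online rule may be used for them. -/
noncomputable def opt {n : ℕ} (F : Fin n → ProbabilityMeasure ℝ≥0)
    (π : Equiv.Perm (Fin n)) : ℝ≥0∞ :=
  ⨆ R : OnlineRule n, R.winProb F π

/-- A deterministic identity-blind algorithm: it knows the distributions of the boxes, but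
neither the arrival order nor the identities of the arriving boxes, so its rule depends on the
distributions only, and its decisions on the values observed so far. -/
abbrev Algorithm : Type :=
  (n : ℕ) → (Fin n → ProbabilityMeasure ℝ≥0) → OnlineRule n

/-- No point has mass more than `ε` under the distribution of the maximum value. -/
def SmallMaxAtoms {n : ℕ} (ε : ℝ≥0) (F : Fin n → ProbabilityMeasure ℝ≥0) : Prop :=
  ∀ x : ℝ≥0, (Measure.pi fun i => (F i : Measure ℝ≥0)) {v | Finset.univ.sup v = x} ≤ ε

/-- The max-probability identity-blindness gap, over the instances with at least one box for
which the maximum value has no point mass larger than `ε`. -/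
noncomputable def gap (ε : ℝ≥0) (ALG : Algorithm) : ℝ≥0∞ :=
  ⨅ (n : ℕ) (_ : 0 < n) (F : Fin n → ProbabilityMeasure ℝ≥0) (_ : SmallMaxAtoms ε F)
    (π : Equiv.Perm (Fin n)), (ALG n F).winProb F π / opt F π

/-- The value of `Γ*` in terms of `lam`. -/
noncomputable def Gam (lam : ℝ) : ℝ :=
  lam * Real.log (1 / lam) / (lam + 1 / Real.exp 1)

/-- `lam` is a solution in `(0, 1)` of
`min_{ρ ≥ lam} (lam ln(1/ρ) + ρ - lam) / (lam + 1 - lam/ρ) = lam ln(1/lam) / (lam + 1/e)`,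
the minimum being attained. -/
def IsLam (lam : ℝ) : Prop :=
  0 < lam ∧ lam < 1 ∧
    IsLeast ((fun ρ : ℝ => (lam * Real.log (1 / ρ) + ρ - lam) / (lam + 1 - lam / ρ)) '' Ici lam)
      (Gam lam)

end IdentityBlind

namespace IdentityBlind

/-! Take `M` boxes, box `k` holding `k + 1` with small probability `p = 1 - x` and `0` otherwise,
hidden among very many empty boxes. As long as only zeros have appeared, a deterministic rule is
described by the set of values it would take at each time. By pigeonhole this set is the same `S` at
`M` of the times, and the adversary places the `M` boxes there in an order depending on `S`. The
boxes outside `S` come last with decreasing values, so a rule that skips the first non-zero value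
has already lost.

Let `q = x ^ |S|` be the probability that every box of `S` is zero. If `q ≥ lam`, the boxes of `S`
arrive with increasing values. The rule wins with probability about `q ln(1/q)`, because all other
boxes of `S` must be zero, while a rule that knows the order restricts itself in `S` to the top
`1/p` boxes and gets about `1/e + q`. If `q ≤ lam`, only the lowest `b` boxes of `S`, with `x ^ b =
ρ`, arrive increasingly and the rest then decreasingly. The rule gets about `q ln(1/ρ) + ρ - q`, and
ignoring the lowest `b` boxes gives about `q + 1 - q/ρ`. Large values outside `S` scale the winning
probabilities inside `S` by factors of at most one. This only lowers the ratio, since the common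
term `q` of the benchmark is not scaled (`upper_le_of_increasing`, `upper_le_of_decreasing`).

The first ratio is at most `Gam lam` for `q ≥ lam`. For the minimizing `ρ` the second is monotone in
`q` and equals `Gam lam` at `q = lam`. Letting `p → 0` and `x ^ M → 0` removes the errors
(`gap_le_add`). -/

/-! ### The equation for `lam`: existence, uniqueness and numerical bounds. -/

theorem inv_exp_one_bounds : 0.36787 < 1 / Real.exp 1 ∧ 1 / Real.exp 1 < 0.36789 := by
  have h1 := Real.exp_one_gt_d9
  have h2 := Real.exp_one_lt_d9
  constructor
  · rw [lt_div_iff₀ (by positivity)]; linarith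
  · rw [div_lt_iff₀ (by positivity)]; linarith

theorem Gam_eq (a : ℝ) : Gam a = a * (Real.log (1 / a) / (1 / Real.exp 1 + a)) := by
  rw [Gam, mul_div_assoc, add_comm]

theorem Gam_mul {a : ℝ} (ha : 0 < a) : Gam a * (a + 1 / Real.exp 1) = a * Real.log (1 / a) := by
  have : 0 < 1 / Real.exp 1 := by positivity
  rw [Gam, div_mul_cancel₀ _ (by positivity)]

/-- The concave function `q ln(1/q)` lies below its tangent at `a`, and the line on the right agrees
with it at `a`. Hypothesis `h` says that the slope `-ln a - 1` of the tangent is at most the slope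
`Gam a` of the line. -/
theorem mul_log_le_Gam_mul {a q : ℝ} (ha : 0 < a) (haq : a ≤ q)
    (h : 0 ≤ Gam a + 1 + Real.log a) : q * Real.log (1 / q) ≤ Gam a * (q + 1 / Real.exp 1) := by
  have hq : 0 < q := ha.trans_le haq
  have h1 := Gam_mul ha
  have h2 : 1 - a / q ≤ Real.log (q / a) := by
    have := Real.one_sub_inv_le_log_of_pos (x := q / a) (by positivity)
    rwa [inv_div] at this
  rw [Real.log_div hq.ne' ha.ne'] at h2
  have h3 : q * (1 - a / q) = q - a := by field_simp
  have h4 := mul_le_mul_of_nonneg_left h2 hq.le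
  simp only [one_div, Real.log_inv] at *
  nlinarith [mul_nonneg (sub_nonneg.2 haq) h]

theorem Gam_anti {a q : ℝ} (ha : 0 < a) (haq : a ≤ q)
    (h : 0 ≤ Gam a + 1 + Real.log a) : Gam q ≤ Gam a := by
  have hq : 0 < q := ha.trans_le haq
  have : 0 < 1 / Real.exp 1 := by positivity
  have h1 := mul_log_le_Gam_mul ha haq h
  rw [Gam, div_le_iff₀ (by positivity)]
  exact h1

theorem log_978 : |Real.log 0.978 + 0.0222456| < 0.00001 := by
  have := Real.abs_log_sub_add_sum_range_le (x := 0.022) (by norm_num [abs_lt]) 3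
  rw [abs_le] at this
  norm_num [Finset.sum_range_succ, abs_of_pos] at this
  rw [abs_lt]; norm_num; constructor <;> linarith [this.1, this.2]

theorem log_982 : |Real.log 0.982 + 0.018164| < 0.00001 := by
  have := Real.abs_log_sub_add_sum_range_le (x := 0.018) (by norm_num [abs_lt]) 3
  rw [abs_le] at this
  norm_num [Finset.sum_range_succ, abs_of_pos] at this
  rw [abs_lt]; norm_num; constructor <;> linarith [this.1, this.2]

theorem log_104725 : Real.log 1.04725 < 0.04618 := by
  have := Real.abs_log_sub_add_sum_range_le (x := -0.04725) (by norm_num [abs_lt]) 4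
  rw [abs_le] at this
  norm_num [Finset.sum_range_succ, abs_of_pos] at this
  norm_num; linarith [this.1, this.2]

theorem log_104825 : 0.04711 < Real.log 1.04825 := by
  have := Real.abs_log_sub_add_sum_range_le (x := -0.04825) (by norm_num [abs_lt]) 4
  rw [abs_le] at this
  norm_num [Finset.sum_range_succ, abs_of_pos] at this
  norm_num; linarith [this.1, this.2]

theorem log_2445 : 1.40852 < Real.log (1 / 0.2445) ∧ Real.log (1 / 0.2445) < 1.40856 := by
  have h : Real.log (1 / 0.2445) = 2 * Real.log 2 - Real.log 0.978 := by
    rw [show (1 / 0.2445 : ℝ) = 2 * 2 / 0.978 by norm_num, Real.log_div (by norm_num) (by norm_num),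
      Real.log_mul (by norm_num) (by norm_num)]; ring
  have := abs_lt.1 log_978
  have h1 := Real.log_two_gt_d9
  have h2 := Real.log_two_lt_d9
  rw [h]; constructor <;> linarith [this.1, this.2]

theorem log_2455 : 1.40443 < Real.log (1 / 0.2455) ∧ Real.log (1 / 0.2455) < 1.40448 := by
  have h : Real.log (1 / 0.2455) = 2 * Real.log 2 - Real.log 0.982 := by
    rw [show (1 / 0.2455 : ℝ) = 2 * 2 / 0.982 by norm_num, Real.log_div (by norm_num) (by norm_num),
      Real.log_mul (by norm_num) (by norm_num)]; ring
  have := abs_lt.1 log_982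
  have h1 := Real.log_two_gt_d9
  have h2 := Real.log_two_lt_d9
  rw [h]; constructor <;> linarith [this.1, this.2]

theorem log_20945 : Real.log 2.0945 < 0.73934 := by
  rw [show (2.0945 : ℝ) = 2 * 1.04725 by norm_num, Real.log_mul (by norm_num) (by norm_num)]
  linarith [log_104725, Real.log_two_lt_d9]

theorem log_20965 : 0.74025 < Real.log 2.0965 := by
  rw [show (2.0965 : ℝ) = 2 * 1.04825 by norm_num, Real.log_mul (by norm_num) (by norm_num)]
  linarith [log_104825, Real.log_two_gt_d9]

/-- The critical ratio `ρ / lam`. -/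
theorem exists_critical_ratio : ∃ c : ℝ, 2.0945 ≤ c ∧ c ≤ 2.0965 ∧
    c - 1 - Real.log c = c * (c - 1) * (1 - 1 / c - 1 / Real.exp 1) := by
  -- Intermediate value theorem; the bracket is narrow enough to fix three decimals of `lam`.
  have hcont : ContinuousOn
      (fun c : ℝ => c - 1 - Real.log c - c * (c - 1) * (1 - 1 / c - 1 / Real.exp 1))
      (Icc 2.0945 2.0965) := by
    have h0 : ∀ c ∈ Icc (2.0945 : ℝ) 2.0965, c ≠ 0 := fun c hc => by
      have := hc.1; norm_num at this; intro h; rw [h] at this; norm_num at this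
    fun_prop (disch := assumption)
  have he := inv_exp_one_bounds
  have := intermediate_value_Icc' (by norm_num) hcont
  have h1 := log_20945
  have h2 := log_20965
  obtain ⟨c, hc, h⟩ := this (show (0 : ℝ) ∈ Icc _ _ by
    constructor <;> norm_num at * <;> linarith)
  exact ⟨c, hc.1, hc.2, by linarith⟩

theorem exists_critical_lam {K : ℝ} (h1 : 2.2924 ≤ K) (h2 : K ≤ 2.2989) :
    ∃ lam : ℝ, 0.2445 < lam ∧ lam < 0.2455 ∧
      Real.log (1 / lam) / (1 / Real.exp 1 + lam) = K := by
  have he := inv_exp_one_bounds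
  have hcont : ContinuousOn (fun l : ℝ => Real.log (1 / l) / (1 / Real.exp 1 + l))
      (Icc 0.2445 0.2455) := by
    have h0 : ∀ c ∈ Icc (0.2445 : ℝ) 0.2455, c ≠ 0 := fun c hc => by
      have := hc.1; norm_num at this; intro h; rw [h] at this; norm_num at this
    have h3 : ∀ c ∈ Icc (0.2445 : ℝ) 0.2455, 1 / Real.exp 1 + c ≠ 0 := fun c hc => by
      have := hc.1; norm_num at *; linarith
    have h4 : ∀ c ∈ Icc (0.2445 : ℝ) 0.2455, 1 / c ≠ 0 := fun c hc => by
      simpa using h0 c hc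
    refine ContinuousOn.div (ContinuousOn.log ?_ h4) (by fun_prop) h3
    fun_prop (disch := assumption)
  have := intermediate_value_Ioo' (by norm_num) hcont
  have h5 := log_2445
  have h6 := log_2455
  obtain ⟨c, hc, h⟩ := this (show K ∈ Ioo _ _ by
    constructor
    · rw [div_lt_iff₀ (by linarith)]
      nlinarith
    · rw [lt_div_iff₀ (by linarith)]
      nlinarith)
  exact ⟨c, hc.1, hc.2, h⟩

/-- With `K = c₀ (c₀ - 1)`, the function `c - 1 - ln c - K (1 - 1/c - 1/e)` has derivative `1 - 1/c
- K/c²`, which vanishes at `c₀`; `h` says that its value there is zero. Bounding `ln (c / c₀)`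
linearly leaves the nonnegative remainder `(c₀ - 1)(c - c₀)² / (c c₀)`. -/
theorem critical_le {c₀ c : ℝ} (h0 : 1 < c₀) (hc : 0 < c)
    (h : c₀ - 1 - Real.log c₀ = c₀ * (c₀ - 1) * (1 - 1 / c₀ - 1 / Real.exp 1)) :
    c₀ * (c₀ - 1) * (1 - 1 / c - 1 / Real.exp 1) ≤ c - 1 - Real.log c := by
  have hp : 0 < c₀ := by linarith
  have h1 : Real.log (c / c₀) ≤ c / c₀ - 1 := Real.log_le_sub_one_of_pos (by positivity)
  rw [Real.log_div hc.ne' hp.ne'] at h1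
  have h2 : 0 ≤ (c₀ - 1) * ((c - c₀) ^ 2 / (c * c₀)) :=
    mul_nonneg (by linarith) (by positivity)
  have h3 : (c₀ - 1) * ((c - c₀) ^ 2 / (c * c₀)) =
      c - c / c₀ + c₀ * (c₀ - 1) / c - 2 * (c₀ - 1) := by
    field_simp; ring
  have h4 : c₀ * (c₀ - 1) * (1 - 1 / c - 1 / Real.exp 1) =
    c₀ * (c₀ - 1) * (1 - 1 / Real.exp 1) - c₀ * (c₀ - 1) / c := by ring
  have h5 : c₀ * (c₀ - 1) * (1 - 1 / c₀ - 1 / Real.exp 1) =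
    c₀ * (c₀ - 1) * (1 - 1 / Real.exp 1) - (c₀ - 1) := by field_simp; ring
  linarith

/-- Comparison of the two performance ratios after the substitution `ρ = c * lam`. -/
theorem Gam_mul_denom_sub {lam c : ℝ} (hl : 0 < lam) (hc : 0 < c) :
    (lam * Real.log (1 / (c * lam)) + c * lam - lam) -
        Gam lam * (lam + 1 - lam / (c * lam)) =
      lam * ((c - 1 - Real.log c) -
        Real.log (1 / lam) / (1 / Real.exp 1 + lam) * (1 - 1 / c - 1 / Real.exp 1)) := by
  have he : 0 < 1 / Real.exp 1 := by positivity
  have h1 : Real.log (1 / (c * lam)) = Real.log (1 / lam) - Real.log c := by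
    rw [one_div, Real.log_inv, Real.log_mul hc.ne' hl.ne', one_div, Real.log_inv]; ring
  have h2 : lam / (c * lam) = 1 / c := by field_simp
  rw [h1, h2, Gam_eq]
  generalize Real.log (1 / lam) = L
  generalize 1 / Real.exp 1 = e at *
  have : e + lam ≠ 0 := by positivity
  field_simp
  ring

theorem denom_pos {lam ρ : ℝ} (hl : 0 < lam) (h : lam ≤ ρ) : 0 < lam + 1 - lam / ρ := by
  have : lam / ρ ≤ 1 := (div_le_one (hl.trans_le h)).2 h
  linarith

/-- Tangency at `c₀` decouples the problem: `c₀` solves an equation free of `lam`, and `lam` is then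
found from `K = c₀ (c₀ - 1)`. The minimum is attained at `ρ = c₀ * lam`. -/
theorem isLam_of_critical {lam c₀ : ℝ} (hl : 0 < lam) (hl1 : lam < 1) (h0 : 1 < c₀)
    (h : c₀ - 1 - Real.log c₀ = c₀ * (c₀ - 1) * (1 - 1 / c₀ - 1 / Real.exp 1))
    (hK : Real.log (1 / lam) / (1 / Real.exp 1 + lam) = c₀ * (c₀ - 1)) : IsLam lam := by
  refine ⟨hl, hl1, ⟨c₀ * lam, ?_, ?_⟩, ?_⟩
  · simp only [mem_Ici]; nlinarith
  · have h1 := Gam_mul_denom_sub hl (c := c₀) (by linarith)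
    simp only
    rw [div_eq_iff (denom_pos hl (by nlinarith)).ne']
    rw [hK, ← h] at h1
    linarith
  · rintro _ ⟨ρ, hρ, rfl⟩
    have hρ' : lam ≤ ρ := hρ
    simp only
    rw [le_div_iff₀ (denom_pos hl hρ')]
    have h1 := Gam_mul_denom_sub hl (c := ρ / lam) (div_pos (by linarith) hl)
    rw [div_mul_cancel₀ _ hl.ne', hK] at h1
    have h2 := critical_le h0 (c := ρ / lam) (div_pos (by linarith) hl) h
    have := mul_nonneg hl.le (sub_nonneg.2 h2)
    linarith

/-- After `ρ = c * lam`, the parameter enters only through `K = ln(1/lam) / (1/e + lam)`, which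
strictly decreases. At the minimizing `c` for `b` equality holds with a positive coefficient of `K`,
so the larger `K` of `a` violates the minimum property of `a`. -/
theorem IsLam.not_lt {a b : ℝ} (ha : IsLam a) (hb : IsLam b) : ¬ a < b := by
  intro hab
  obtain ⟨ha0, ha1, -, haL⟩ := ha
  obtain ⟨hb0, hb1, ⟨ρ, hρ, hρe⟩, -⟩ := hb
  have hρ' : b ≤ ρ := hρ
  have hρ0 : 0 < ρ := by linarith
  have he : 0 < 1 / Real.exp 1 := by positivity
  simp only at hρe
  rw [div_eq_iff (denom_pos hb0 hρ').ne'] at hρe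
  obtain ⟨c, rfl⟩ : ∃ c, ρ = c * b := ⟨ρ / b, by field_simp⟩
  have hc : 1 ≤ c := by
    by_contra h
    push Not at h
    nlinarith
  have h1 := Gam_mul_denom_sub hb0 (c := c) (by linarith)
  rw [hρe, sub_self, eq_comm, mul_eq_zero] at h1
  replace h1 := h1.resolve_left hb0.ne'
  have h2 := haL ⟨c * a, by simp only [mem_Ici]; nlinarith, rfl⟩
  simp only at h2
  rw [le_div_iff₀ (denom_pos ha0 (by nlinarith)), ← sub_nonneg,
    Gam_mul_denom_sub ha0 (by linarith)] at h2
  replace h2 := nonneg_of_mul_nonneg_right h2 ha0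
  have hK : Real.log (1 / b) / (1 / Real.exp 1 + b) < Real.log (1 / a) / (1 / Real.exp 1 + a) := by
    have hb2 : 0 < Real.log (1 / b) := Real.log_pos (by rw [lt_div_iff₀ hb0]; linarith)
    have hab2 : Real.log (1 / b) < Real.log (1 / a) :=
      Real.log_lt_log (by positivity) (one_div_lt_one_div_of_lt ha0 hab)
    exact div_lt_div₀ hab2 (by linarith) (by linarith) (by positivity)
  have hKb : 0 < Real.log (1 / b) / (1 / Real.exp 1 + b) :=
    div_pos (Real.log_pos (by rw [lt_div_iff₀ hb0]; linarith)) (by positivity)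
  have hlog : Real.log c ≤ c - 1 := Real.log_le_sub_one_of_pos (by linarith)
  rcases eq_or_lt_of_le hc with rfl | hc1
  · rw [Real.log_one] at h1
    have := mul_pos hKb he
    linarith
  · have hlog' : Real.log c < c - 1 := Real.log_lt_sub_one_of_pos (by linarith) hc1.ne'
    -- The left side of `h1` is positive by `hlog'`, so the factor multiplying `K` must be too.
    have hD : 0 < 1 - 1 / c - 1 / Real.exp 1 := by
      by_contra hD
      push Not at hD
      nlinarith
    nlinarith

/-- The two extra facts feed the main bound: `0 ≤ Gam lam + 1 + ln lam` treats `q ≥ lam`, and `ρ ≤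
ln(1/ρ)` at the minimizing `ρ` treats `q ≤ lam`. -/
theorem exists_isLam : ∃ lam : ℝ, IsLam lam ∧ 0.2445 < lam ∧ lam < 0.2455 ∧
    0.5615 < Gam lam ∧ Gam lam < 0.5625 ∧ 0 ≤ Gam lam + 1 + Real.log lam ∧
    ∃ ρ : ℝ, lam < ρ ∧ ρ < 1 ∧ ρ ≤ Real.log (1 / ρ) ∧
      lam * Real.log (1 / ρ) + ρ - lam = Gam lam * (lam + 1 - lam / ρ) := by
  have he := inv_exp_one_bounds
  obtain ⟨c, hc1, hc2, hc⟩ := exists_critical_ratio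
  obtain ⟨lam, hl1, hl2, hK⟩ := exists_critical_lam (K := c * (c - 1)) (by nlinarith) (by nlinarith)
  have hl0 : 0 < lam := by linarith
  have h1 := log_2445
  have h2 := log_2455
  have hlog : ∀ a : ℝ, Real.log (1 / a) = - Real.log a := fun a => by rw [one_div, Real.log_inv]
  have hL : Real.log (1 / lam) < Real.log (1 / 0.2445) :=
    Real.log_lt_log (by positivity) (one_div_lt_one_div_of_lt (by norm_num) hl1)
  have hL' : Real.log (1 / 0.2455) < Real.log (1 / lam) :=
    Real.log_lt_log (by norm_num) (one_div_lt_one_div_of_lt hl0 hl2)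
  have g1 : Gam 0.2445 < 0.5625 := by
    rw [Gam, div_lt_iff₀ (by linarith)]; nlinarith
  have g2 : 0.5 < Gam 0.2445 := by
    rw [Gam, lt_div_iff₀ (by linarith)]; nlinarith
  have g3 : 0.5615 < Gam 0.2455 := by
    rw [Gam, lt_div_iff₀ (by linarith)]; nlinarith
  have g4 : Gam lam ≤ Gam 0.2445 := Gam_anti (by norm_num) hl1.le (by linarith [hlog 0.2445])
  have g0 : 0.5 < Gam lam := by
    rw [Gam, lt_div_iff₀ (by linarith)]; nlinarith
  have g5 : 0 ≤ Gam lam + 1 + Real.log lam := by linarith [hlog lam]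
  have g6 : Gam 0.2455 ≤ Gam lam := Gam_anti hl0 hl2.le g5
  refine ⟨lam, isLam_of_critical hl0 (by linarith) (by linarith) hc hK, hl1, hl2, by linarith,
    by linarith, g5, c * lam, by nlinarith, by nlinarith, ?_, ?_⟩
  · have h3 : Real.log (1 / (c * lam)) = Real.log (1 / lam) - Real.log c := by
      rw [one_div, Real.log_inv, Real.log_mul (by linarith) hl0.ne', one_div, Real.log_inv]; ring
    have h4 : Real.log c ≤ Real.log 2 + (c / 2 - 1) := by
      have := Real.log_le_sub_one_of_pos (x := c / 2) (by linarith)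
      rw [Real.log_div (by linarith) (by norm_num)] at this
      linarith
    have h5 := Real.log_two_lt_d9
    rw [h3]
    nlinarith
  · have h3 := Gam_mul_denom_sub hl0 (c := c) (by linarith)
    rw [hK, ← hc] at h3
    linarith

/-! ### Two-point distributions. -/

/-- The law that puts mass `p` on `a` and mass `x = 1 - p` on `0`. -/
noncomputable def twoPoint (x p : ℝ≥0) (h : x + p = 1) (a : ℝ≥0) : ProbabilityMeasure ℝ≥0 :=
  ⟨x • Measure.dirac 0 + p • Measure.dirac a, ⟨by
    simp only [Measure.coe_add, Measure.coe_nnreal_smul_apply, Pi.add_apply, measure_univ, mul_one]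
    exact_mod_cast h⟩⟩

section TwoPoint

variable {x p : ℝ≥0} (h : x + p = 1) (a : ℝ≥0)

theorem twoPoint_apply (s : Set ℝ≥0) : (twoPoint x p h a : Measure ℝ≥0) s =
    x * s.indicator 1 0 + p * s.indicator 1 a := by
  simp only [twoPoint, ProbabilityMeasure.coe_mk, Measure.coe_add, Pi.add_apply,
    Measure.coe_nnreal_smul_apply, Measure.dirac_apply]

theorem twoPoint_self (ha : a ≠ 0) : (twoPoint x p h a : Measure ℝ≥0) {a} = p := by
  simp [twoPoint_apply, ha.symm]

theorem twoPoint_zero (ha : a ≠ 0) : (twoPoint x p h a : Measure ℝ≥0) {0} = x := by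
  simp [twoPoint_apply, ha]

theorem twoPoint_zero_zero : (twoPoint x p h 0 : Measure ℝ≥0) {0} = 1 := by
  simp only [twoPoint_apply, mem_singleton_iff, indicator_of_mem, Pi.one_apply, mul_one]
  exact_mod_cast h

theorem twoPoint_pair : (twoPoint x p h a : Measure ℝ≥0) {0, a} = 1 := by
  simp only [twoPoint_apply, mem_insert_iff, mem_singleton_iff, true_or, or_true,
    indicator_of_mem, Pi.one_apply, mul_one]
  exact_mod_cast h

end TwoPoint

/-- The outcomes where the value at time `e k` is not zero and those at the times in `e '' Z`
are. -/
def box {n M : ℕ} (a : Fin n → ℝ≥0) (e : Fin M → Fin n) (k : Fin M) (Z : Finset (Fin M)) :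
    Set (Fin n → ℝ≥0) :=
  univ.pi fun i => if i = e k then {a i} else if i ∈ Z.image e then {0} else {0, a i}

/-! ### Winning probabilities when box `k` arrives at time `e k`. -/

section Law

variable {x p : ℝ≥0} (h : x + p = 1) {n M : ℕ} {a : Fin n → ℝ≥0} {e : Fin M → Fin n}
  (he : Function.Injective e) (ha : ∀ k, a (e k) = k + 1) (ha0 : ∀ i ∉ range e, a i = 0)

theorem ae_mem_pair :
    ∀ᵐ v ∂(Measure.pi fun i => (twoPoint x p h (a i) : Measure ℝ≥0)), ∀ i, v i = 0 ∨ v i = a i := by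
  have h1 : (Measure.pi fun i => (twoPoint x p h (a i) : Measure ℝ≥0))
      (univ.pi fun i => {0, a i}) = 1 := by
    rw [Measure.pi_pi]; simp [twoPoint_pair]
  have h2 : MeasurableSet (univ.pi fun i => ({0, a i} : Set ℝ≥0)) :=
    MeasurableSet.univ_pi fun i => by measurability
  have := (prob_compl_eq_zero_iff h2).2 h1
  filter_upwards [compl_mem_ae_iff.2 this] with v hv
  simpa using hv

include he ha

theorem pi_box {k : Fin M} {Z : Finset (Fin M)} (hk : k ∉ Z) :
    (Measure.pi fun i => (twoPoint x p h (a i) : Measure ℝ≥0)) (box a e k Z) =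
      ((p * x ^ Z.card : ℝ≥0) : ℝ≥0∞) := by
  have hne : ∀ k, a (e k) ≠ 0 := fun k => by rw [ha]; positivity
  rw [box, Measure.pi_pi, ← Fintype.prod_of_injective e he
    (fun j => (if j = k then (p : ℝ≥0∞) else 1) * (if j ∈ Z then (x : ℝ≥0∞) else 1))]
  · rw [Finset.prod_mul_distrib, Finset.prod_ite_eq' Finset.univ k, if_pos (Finset.mem_univ _),
      Finset.prod_ite_mem, Finset.univ_inter, Finset.prod_const]
    push_cast; rfl
  · intro i hi
    have h1 : i ≠ e k := fun hh => hi ⟨k, hh.symm⟩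
    have h2 : i ∉ Z.image e := fun hh => by
      obtain ⟨j, -, hj⟩ := Finset.mem_image.1 hh
      exact hi ⟨j, hj⟩
    rw [if_neg h1, if_neg h2, twoPoint_pair]
  · intro j
    by_cases hj : j = k
    · subst hj
      simp [hk, twoPoint_self h _ (hne j)]
    · by_cases hZ : j ∈ Z
      · simp [hj, hZ, he.eq_iff, twoPoint_zero h _ (hne j)]
      · simp [hj, hZ, he.eq_iff, twoPoint_pair]

include ha0

theorem pi_zero :
    (Measure.pi fun i => (twoPoint x p h (a i) : Measure ℝ≥0)) {0} =
      ((x ^ M : ℝ≥0) : ℝ≥0∞) := by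
  have hne : ∀ k, a (e k) ≠ 0 := fun k => by rw [ha]; positivity
  have : ({0} : Set (Fin n → ℝ≥0)) = univ.pi fun _ => {0} := by
    ext v; simp [funext_iff]
  rw [this, Measure.pi_pi, ← Fintype.prod_of_injective e he (fun _ => (x : ℝ≥0∞))]
  · simp
  · intro i hi
    rw [ha0 i hi, twoPoint_zero_zero]
  · intro j
    rw [twoPoint_zero h _ (hne j)]

/-- An upper bound for the winning probability of a rule that never wants the first non-zero
value unless it belongs to `S`, when after every value outside `S` only smaller ones arrive. -/
theorem winProb_le (R : OnlineRule n) (F : Fin n → ProbabilityMeasure ℝ≥0)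
    (π : Equiv.Perm (Fin n)) (hF : ∀ i, F (π i) = twoPoint x p h (a i)) (S : Finset (Fin M))
    (hS : ∀ k, (fun j : Iic (e k) => if (j : Fin n) = e k then (k + 1 : ℝ≥0) else 0) ∈
      R.acc (e k) ↔ k ∈ S)
    (hdec : ∀ k ∉ S, ∀ j, e k < e j → j < k) :
    R.winProb F π ≤ ((x ^ M + ∑ k ∈ S, p * x ^
      (Finset.univ.filter fun j => e j < e k ∨ k < j).card : ℝ≥0) : ℝ≥0∞) := by
  set Z : Fin M → Finset (Fin M) := fun k => Finset.univ.filter fun j => e j < e k ∨ k < j with hZ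
  -- Apart from the all-zero outcome, a win forces the first non-zero value to be in `S`, accepted,
  -- and maximal: everything before it and everything larger is zero.
  have hsub : ∀ v : Fin n → ℝ≥0, (∀ i, v i = 0 ∨ v i = a i) →
      (∃ i, R.Accepts v i ∧ v i = Finset.univ.sup v) →
      v ∈ ({0} ∪ ⋃ k ∈ S, box a e k (Z k) : Set (Fin n → ℝ≥0)) := by
    rintro v hv ⟨i, hi, hmax⟩
    by_cases hv0 : v = 0
    · exact Or.inl hv0
    right
    have hle : ∀ j, v j ≤ v i := fun j => hmax ▸ Finset.le_sup (Finset.mem_univ j)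
    have hlev : ∀ j, v j ≠ 0 → ∃ k, j = e k ∧ v j = k + 1 := fun j hj => by
      by_cases hr : j ∈ range e
      · obtain ⟨k, rfl⟩ := hr
        exact ⟨k, rfl, by rw [(hv _).resolve_left hj, ha]⟩
      · exact absurd ((hv j).resolve_left hj) (by rwa [ha0 j hr])
    have hex : ∃ j, v j ≠ 0 := by
      by_contra hcon
      push Not at hcon
      exact hv0 (funext hcon)
    obtain ⟨t, ht, htmin⟩ : ∃ t, v t ≠ 0 ∧ ∀ j < t, v j = 0 := by
      have hne : (Finset.univ.filter fun j => v j ≠ 0).Nonempty := by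
        obtain ⟨j, hj⟩ := hex
        exact ⟨j, by simpa using hj⟩
      refine ⟨Finset.min' _ hne, by simpa using Finset.min'_mem _ hne, fun j hj => ?_⟩
      by_contra hcon
      exact absurd (Finset.min'_le _ j (by simpa using hcon)) (not_le.2 hj)
    obtain ⟨k, rfl, hk⟩ := hlev t ht
    have hi0 : v i ≠ 0 := fun hh => ht (le_antisymm (hh ▸ hle _) (zero_le))
    have hki : e k ≤ i := by
      by_contra hcon
      exact hi0 (htmin i (not_le.1 hcon))
    have hwant : R.Wants v (e k) ↔ k ∈ S := by
      rw [← hS k, OnlineRule.Wants]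
      have : (fun j : Iic (e k) => v j) =
          fun j : Iic (e k) => if (j : Fin n) = e k then (k + 1 : ℝ≥0) else 0 := by
        funext j
        by_cases hj : (j : Fin n) = e k
        · rw [if_pos hj, hj, hk]
        · rw [if_neg hj, htmin _ (lt_of_le_of_ne j.2 hj)]
      rw [this]
    obtain ⟨m, rfl, hm⟩ := hlev i hi0
    by_cases hkS : k ∈ S
    · have hmk : m = k := by
        by_contra hcon
        exact hi.2 (e k) (lt_of_le_of_ne hki fun hh => hcon (he hh).symm) (hwant.2 hkS)
      subst hmk
      refine mem_iUnion₂.2 ⟨m, hkS, fun i _ => ?_⟩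
      by_cases h1 : i = e m
      · subst h1
        simp [hm, ha]
      · by_cases h2 : i ∈ (Z m).image e
        · simp only [h1, h2, if_true, if_false]
          obtain ⟨j, hj, rfl⟩ := Finset.mem_image.1 h2
          simp only [hZ, Finset.mem_filter, Finset.mem_univ, true_and] at hj
          rcases hj with hj | hj
          · exact htmin _ hj
          · by_contra hcon
            have h3 := hle (e j)
            rw [(hv (e j)).resolve_left hcon, hm, ha] at h3
            have h4 : (j : ℝ≥0) ≤ m := by simpa using h3
            exact absurd (by exact_mod_cast h4 : j ≤ m) (not_le.2 hj)
        · simp only [h1, h2, if_false]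
          exact hv i
    -- The first non-zero value was skipped, and by `hdec` whatever is accepted later is smaller.
    · exfalso
      have hmk : m ≠ k := by
        rintro rfl
        exact hkS (hwant.1 hi.1)
      have h1 := hdec k hkS m (lt_of_le_of_ne hki fun hh => hmk (he hh).symm)
      have h3 := hle (e k)
      rw [hk, hm] at h3
      have h4 : (k : ℝ≥0) ≤ m := by simpa using h3
      exact absurd (by exact_mod_cast h4 : k ≤ m) (not_le.2 h1)
  rw [OnlineRule.winProb, arrivalLaw]
  simp only [hF]
  calc (Measure.pi fun i => (twoPoint x p h (a i) : Measure ℝ≥0)) _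
      ≤ (Measure.pi fun i => (twoPoint x p h (a i) : Measure ℝ≥0))
          ({0} ∪ ⋃ k ∈ S, box a e k (Z k)) := by
        refine measure_mono_ae ?_
        filter_upwards [ae_mem_pair h] with v hv hw
        exact hsub v hv hw
    _ ≤ _ := (measure_union_le _ _).trans (add_le_add le_rfl (measure_biUnion_finset_le _ _))
    _ = _ := by
        rw [pi_zero h he ha ha0]
        push_cast
        congr 1
        refine Finset.sum_congr rfl fun k _ => ?_
        rw [pi_box h he ha (by simp [hZ])]
        push_cast; rfl

/-- The rule that accepts the first non-zero value that arrives at a time in `T`. -/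
def firstNonzero (T : Set (Fin n)) : OnlineRule n where
  acc i := {w | i ∈ T ∧ w ⟨i, mem_Iic.2 le_rfl⟩ ≠ 0}
  measurable_acc i := by
    by_cases hi : i ∈ T
    · simp only [hi, true_and]
      exact measurable_pi_apply (X := fun _ : Iic i => ℝ≥0) (⟨i, mem_Iic.2 le_rfl⟩ : Iic i)
        (measurableSet_singleton (0 : ℝ≥0)).compl
    · simp [hi]

theorem le_opt (F : Fin n → ProbabilityMeasure ℝ≥0)
    (π : Equiv.Perm (Fin n)) (hF : ∀ i, F (π i) = twoPoint x p h (a i)) (G : Finset (Fin M)) :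
    ((∑ k ∈ G, p * x ^
      (Finset.univ.filter fun j => (j ∈ G ∧ e j < e k) ∨ k < j).card : ℝ≥0) : ℝ≥0∞) ≤
    opt F π := by
  refine le_trans ?_ (le_iSup _ (firstNonzero (e '' (G : Set (Fin M)))))
  set Z : Fin M → Finset (Fin M) :=
    fun k => Finset.univ.filter fun j => (j ∈ G ∧ e j < e k) ∨ k < j with hZ
  rw [OnlineRule.winProb, arrivalLaw]
  simp only [hF]
  have hval : ∀ k, ∀ v ∈ box a e k (Z k), v (e k) = k + 1 := fun k v hv => by
    have := hv (e k) trivial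
    simpa [ha] using this
  have hzero : ∀ k, ∀ v ∈ box a e k (Z k), ∀ j ∈ Z k, v (e j) = 0 := fun k v hv j hj => by
    have := hv (e j) trivial
    have hjk : j ≠ k := by rintro rfl; simp [hZ] at hj
    simpa [he.eq_iff, hjk, hj] using this
  -- The earlier of two times in `G` carries a non-zero value in its own box event and zero in the
  -- other.
  have hdisj : ∀ k ∈ G, ∀ m ∈ G, e k < e m → Disjoint (box a e k (Z k)) (box a e m (Z m)) := by
    intro k hk m hm hkm
    refine Set.disjoint_left.2 fun v hv hv' => ?_
    have h1 := hval k v hv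
    rw [hzero m v hv' k (by simp [hZ, hk, hkm])] at h1
    exact absurd h1.symm (by positivity)
  calc _ = ∑ k ∈ G, (Measure.pi fun i => (twoPoint x p h (a i) : Measure ℝ≥0))
          (box a e k (Z k)) := by
        push_cast
        refine Finset.sum_congr rfl fun k _ => ?_
        rw [pi_box h he ha (by simp [hZ])]
        push_cast; rfl
    _ = (Measure.pi fun i => (twoPoint x p h (a i) : Measure ℝ≥0))
          (⋃ k ∈ G, box a e k (Z k)) := by
        rw [measure_biUnion_finset]
        · intro k hk m hm hkm
          rcases lt_or_gt_of_ne (he.ne hkm) with hlt | hlt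
          · exact hdisj k hk m hm hlt
          · exact (hdisj m hm k hk hlt).symm
        · intro k _
          refine MeasurableSet.univ_pi fun i => ?_
          split_ifs <;> measurability
    _ ≤ _ := by
        refine measure_mono fun v hv => ?_
        obtain ⟨k, hk, hv⟩ := mem_iUnion₂.1 hv
        have h1 := hval k v hv
        refine ⟨e k, ⟨⟨⟨k, hk, rfl⟩, fun h2 => ?_⟩, ?_⟩, ?_⟩
        · exact absurd (h1.symm.trans h2) (by positivity)
        · rintro _ hlt ⟨⟨j, hj, rfl⟩, hne⟩
          exact hne (hzero k v hv j (by simp [hZ, hlt, Finset.mem_coe.1 hj]))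
        · refine le_antisymm (Finset.le_sup (Finset.mem_univ _)) (Finset.sup_le fun i _ => ?_)
          by_cases hi : i ∈ range e
          · obtain ⟨j, rfl⟩ := hi
            rcases lt_or_ge k j with hkj | hkj
            · rw [hzero k v hv j (by simp [hZ, hkj])]; exact zero_le
            · have h2 : v (e j) ≤ a (e j) := by
                have := hv (e j) trivial
                simp only at this
                split_ifs at this
                · exact le_of_eq this
                · rw [mem_singleton_iff.1 this]; exact zero_le
                · rcases this with this | this
                  · rw [this]; exact zero_le
                  · exact le_of_eq this
              refine h2.trans ?_
              rw [ha, h1]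
              have : (j : ℕ) ≤ k := hkj
              gcongr
          · have h2 : v i = 0 := by
              have := hv i trivial
              have h3 : i ≠ e k := fun hh => hi ⟨k, hh.symm⟩
              simpa [h3, ha0 i hi] using this
            rw [h2]; exact zero_le

end Law

/-! ### The adversary's orders and the resulting combinatorial bounds. -/

section Orders

variable {M : ℕ}

theorem exists_top_subset (S : Finset (Fin M)) {t : ℕ} (ht : t ≤ S.card) :
    ∃ T ⊆ S, T.card = t ∧ ∀ a ∈ S \ T, ∀ b ∈ T, a < b := by
  induction t with
  | zero => exact ⟨∅, by simp, by simp, by simp⟩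
  | succ t ih =>
    obtain ⟨T, hTS, hT, hlt⟩ := ih (by omega)
    have hne : (S \ T).Nonempty := by
      rw [← Finset.card_pos, Finset.card_sdiff_of_subset hTS]; omega
    have hm := Finset.max'_mem _ hne
    set m := (S \ T).max' hne
    have hm' := Finset.mem_sdiff.1 hm
    refine ⟨insert m T, Finset.insert_subset hm'.1 hTS, by
      rw [Finset.card_insert_of_notMem hm'.2, hT], fun a ha b hb => ?_⟩
    simp only [Finset.mem_sdiff, Finset.mem_insert, not_or] at ha
    have haS : a ∈ S \ T := Finset.mem_sdiff.2 ⟨ha.1, ha.2.2⟩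
    rcases Finset.mem_insert.1 hb with rfl | hb
    · exact lt_of_le_of_ne (Finset.le_max' _ _ haS) ha.2.1
    · exact hlt a haS b hb

/-- Both sides are the probability that some box of `A` is non-zero, split on the left according to
the largest such box. -/
theorem sum_mul_pow_card_above {x p : ℝ} (h : x + p = 1) (A : Finset (Fin M)) :
    ∑ k ∈ A, p * x ^ (A.filter fun j => k < j).card = 1 - x ^ A.card := by
  induction A using Finset.induction_on_min with
  | empty => simp
  | insert a A hlt ih =>
    have ha : a ∉ A := fun h => lt_irrefl _ (hlt a h)
    rw [Finset.sum_insert ha, Finset.card_insert_of_notMem ha]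
    have h1 : (insert a A).filter (fun j => a < j) = A := by
      ext j
      simp only [Finset.mem_filter, Finset.mem_insert]
      constructor
      · rintro ⟨rfl | h, h2⟩
        · exact absurd h2 (lt_irrefl _)
        · exact h
      · exact fun h => ⟨Or.inr h, hlt j h⟩
    have h2 : ∑ k ∈ A, p * x ^ ((insert a A).filter fun j => k < j).card =
        ∑ k ∈ A, p * x ^ (A.filter fun j => k < j).card := by
      refine Finset.sum_congr rfl fun k hk => ?_
      rw [Finset.filter_insert, if_neg (not_lt.2 (hlt k hk).le)]
    rw [h1, h2, ih]
    have : p = 1 - x := by linarith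
    rw [this]; ring

/-- The order of arrival: first `S \ D` with increasing values, then `D ∩ S` with decreasing
values, then the complement of `S` with decreasing values. -/
def orderKey (S D : Finset (Fin M)) (k : Fin M) : ℕ :=
  if k ∈ S then if k ∈ D then M + (M - k) else k else 2 * M + 1 + (M - k)

theorem orderKey_injective (S D : Finset (Fin M)) : Function.Injective (orderKey S D) := by
  intro i j hij
  have hi := i.2
  have hj := j.2
  apply Fin.ext
  unfold orderKey at hij
  split_ifs at hij <;> omega

theorem lt_of_orderKey_lt {S D : Finset (Fin M)} {k j : Fin M} (hk : k ∉ S)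
    (h : orderKey S D k < orderKey S D j) : j < k := by
  have hi := k.2
  have hj := j.2
  rw [Fin.lt_def]
  unfold orderKey at h
  rw [if_neg hk] at h
  split_ifs at h <;> omega

/-- The number of values outside `S` that are larger than `k`. -/
def above (S : Finset (Fin M)) (k : Fin M) : ℕ := (Sᶜ.filter fun j => k < j).card

theorem above_anti (S : Finset (Fin M)) {k m : Fin M} (h : k ≤ m) : above S m ≤ above S k :=
  Finset.card_le_card fun j hj => by
    simp only [Finset.mem_filter] at *
    exact ⟨hj.1, h.trans_lt hj.2⟩

/-- The bound of `winProb_le`. -/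
noncomputable def upper (x p : ℝ) (S : Finset (Fin M)) (key : Fin M → ℕ) : ℝ :=
  x ^ M + ∑ k ∈ S, p * x ^ (Finset.univ.filter fun j => key j < key k ∨ k < j).card

/-- The bound of `le_opt`. -/
noncomputable def lower (x p : ℝ) (G : Finset (Fin M)) (key : Fin M → ℕ) : ℝ :=
  ∑ k ∈ G, p * x ^ (Finset.univ.filter fun j => (j ∈ G ∧ key j < key k) ∨ k < j).card

variable {x p : ℝ}

theorem card_add_above_le {S A Z : Finset (Fin M)} {k : Fin M} (hA : A ⊆ S) (hAZ : A ⊆ Z)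
    (hZ : ∀ j ∉ S, k < j → j ∈ Z) : A.card + above S k ≤ Z.card := by
  rw [above, ← Finset.card_union_of_disjoint]
  · refine Finset.card_le_card (Finset.union_subset hAZ fun j hj => ?_)
    simp only [Finset.mem_filter, Finset.mem_compl] at hj
    exact hZ j hj.1 hj.2
  · refine Finset.disjoint_left.2 fun j hj hj' => ?_
    simp only [Finset.mem_filter, Finset.mem_compl] at hj'
    exact hj'.1 (hA hj)

theorem card_le_add_above {S A Z : Finset (Fin M)} {k : Fin M}
    (hZ : ∀ j ∈ Z, j ∈ A ∨ (j ∉ S ∧ k < j)) : Z.card ≤ A.card + above S k := by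
  rw [above]
  refine le_trans (Finset.card_le_card fun j hj => ?_) (Finset.card_union_le _ _)
  simpa using hZ j hj

/-- The contribution of the complement of `S` to `lower`. -/
theorem le_sum_compl (hx : 0 < x) (hx1 : x ≤ 1) (hp : 0 ≤ p) (h : x + p = 1)
    (S D T : Finset (Fin M)) :
    x ^ S.card - x ^ M ≤ ∑ k ∈ Sᶜ, p * x ^ (Finset.univ.filter fun j =>
      (j ∈ T ∪ Sᶜ ∧ orderKey S D j < orderKey S D k) ∨ k < j).card := by
  have h1 := sum_mul_pow_card_above h Sᶜ
  have hc : S.card + Sᶜ.card = M := by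
    rw [Finset.card_add_card_compl, Fintype.card_fin]
  calc x ^ S.card - x ^ M = x ^ S.card * ∑ k ∈ Sᶜ, p * x ^ (Sᶜ.filter fun j => k < j).card := by
        rw [h1, mul_sub, ← pow_add, hc, mul_one]
    _ ≤ _ := by
        rw [Finset.mul_sum]
        refine Finset.sum_le_sum fun k hk => ?_
        rw [mul_left_comm, ← pow_add]
        refine mul_le_mul_of_nonneg_left (pow_le_pow_of_le_one hx.le hx1 ?_) hp
        refine card_le_add_above fun j hj => ?_
        by_cases hjS : j ∈ S
        · exact Or.inl hjS
        · refine Or.inr ⟨hjS, ?_⟩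
          simp only [Finset.mem_filter, Finset.mem_univ, true_and] at hj
          rcases hj with hj | hj
          · exact lt_of_orderKey_lt hjS hj.2
          · exact hj

theorem lower_split {S D T : Finset (Fin M)} (hx : 0 < x) (hx1 : x ≤ 1) (hp : 0 ≤ p)
    (h : x + p = 1) (hT : T ⊆ S) :
    (∑ k ∈ T, p * x ^ (Finset.univ.filter fun j =>
      (j ∈ T ∪ Sᶜ ∧ orderKey S D j < orderKey S D k) ∨ k < j).card) + (x ^ S.card - x ^ M) ≤
    lower x p (T ∪ Sᶜ) (orderKey S D) := by
  rw [lower, Finset.sum_union (Finset.disjoint_left.2 fun j hj hj' =>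
    Finset.mem_compl.1 hj' (hT hj))]
  exact add_le_add le_rfl (le_sum_compl hx hx1 hp h S D T)

/-- In increasing order every other box of `S` is either earlier or larger, so all `|S| - 1` of them
must be zero. -/
theorem upper_increasing (hx : 0 < x) (hx1 : x ≤ 1) (hp : 0 ≤ p) (S : Finset (Fin M)) :
    upper x p S (orderKey S ∅) ≤
      x ^ M + p * x ^ (S.card - 1) * ∑ k ∈ S, x ^ above S k := by
  rw [upper, Finset.mul_sum]
  refine add_le_add le_rfl (Finset.sum_le_sum fun k hk => ?_)
  rw [mul_assoc, ← pow_add]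
  refine mul_le_mul_of_nonneg_left (pow_le_pow_of_le_one hx.le hx1 ?_) hp
  rw [← Finset.card_erase_of_mem hk]
  refine card_add_above_le (Finset.erase_subset _ _) (fun j hj => ?_) (fun j _ hj => by simp [hj])
  rw [Finset.mem_erase] at hj
  rcases lt_or_gt_of_ne hj.1 with hlt | hlt
  · simp [orderKey, hj.2, hk, hlt]
  · simp [hlt]

/-- As `T` is the top part of `S`, the ignored boxes of `S` never beat a box of `T`, so only `|T| -
1` boxes of `S` must be zero. -/
theorem lower_increasing (hx : 0 < x) (hx1 : x ≤ 1) (hp : 0 ≤ p) (h : x + p = 1)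
    {S T : Finset (Fin M)} (hT : T ⊆ S) (hTS : ∀ a ∈ S \ T, ∀ b ∈ T, a < b) :
    p * x ^ (T.card - 1) * (∑ k ∈ T, x ^ above S k) + (x ^ S.card - x ^ M) ≤
      lower x p (T ∪ Sᶜ) (orderKey S ∅) := by
  refine le_trans (add_le_add ?_ le_rfl) (lower_split hx hx1 hp h hT)
  rw [Finset.mul_sum]
  refine Finset.sum_le_sum fun k hk => ?_
  rw [mul_assoc, ← pow_add]
  refine mul_le_mul_of_nonneg_left (pow_le_pow_of_le_one hx.le hx1 ?_) hp
  rw [← Finset.card_erase_of_mem hk]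
  refine card_le_add_above fun j hj => ?_
  simp only [Finset.mem_filter, Finset.mem_univ, true_and, Finset.mem_union,
    Finset.mem_compl] at hj
  have hkM := k.2
  have hkS := hT hk
  by_cases hjS : j ∈ S
  · left
    rw [Finset.mem_erase]
    rcases hj with ⟨hj | hj, hlt⟩ | hj
    · exact ⟨by rintro rfl; exact lt_irrefl _ hlt, hj⟩
    · exact absurd hjS hj
    · refine ⟨hj.ne', ?_⟩
      by_contra hcon
      exact lt_asymm hj (hTS j (Finset.mem_sdiff.2 ⟨hjS, hcon⟩) k hk)
  · right
    refine ⟨hjS, ?_⟩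
    rcases hj with ⟨-, hlt⟩ | hj
    · exact lt_of_orderKey_lt hjS hlt
    · exact hj

/-- For a box of `T` the earlier boxes of `T` are exactly the larger ones. The requirement inside
`T` is therefore mere maximality, at the price of all of `S \ T` being zero. -/
theorem upper_decreasing (hx : 0 < x) (hx1 : x ≤ 1) (hp : 0 ≤ p) {S T : Finset (Fin M)}
    (hT : T ⊆ S) (hTS : ∀ a ∈ S \ T, ∀ b ∈ T, a < b) :
    upper x p S (orderKey S T) ≤
      x ^ M + (p * x ^ (S.card - 1) * (∑ k ∈ S \ T, x ^ above S k) +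
        x ^ (S.card - T.card) *
          ∑ k ∈ T, p * x ^ (T.filter fun j => k < j).card * x ^ above S k) := by
  rw [upper, ← Finset.sum_sdiff hT, Finset.mul_sum, Finset.mul_sum]
  refine add_le_add le_rfl (add_le_add (Finset.sum_le_sum fun k hk => ?_)
    (Finset.sum_le_sum fun k hk => ?_))
  · have hk' := Finset.mem_sdiff.1 hk
    have hkM := k.2
    rw [mul_assoc, ← pow_add]
    refine mul_le_mul_of_nonneg_left (pow_le_pow_of_le_one hx.le hx1 ?_) hp
    rw [← Finset.card_erase_of_mem hk'.1]
    refine card_add_above_le (Finset.erase_subset _ _) (fun j hj => ?_)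
      (fun j _ hj => by simp [hj])
    rw [Finset.mem_erase] at hj
    rcases lt_or_gt_of_ne hj.1 with hlt | hlt
    · have hjT : j ∉ T := fun hjT => lt_asymm hlt (hTS k hk j hjT)
      simp [orderKey, hj.2, hk'.1, hk'.2, hjT, hlt]
    · simp [hlt]
  · have hkS := hT hk
    rw [mul_assoc, mul_left_comm, ← pow_add, ← pow_add]
    refine mul_le_mul_of_nonneg_left (pow_le_pow_of_le_one hx.le hx1 ?_) hp
    rw [← add_assoc, ← Finset.card_sdiff_of_subset hT, ← Finset.card_union_of_disjoint]
    · refine card_add_above_le (Finset.union_subset Finset.sdiff_subset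
        ((Finset.filter_subset _ _).trans hT)) (fun j hj => ?_) (fun j _ hj => by simp [hj])
      rcases Finset.mem_union.1 hj with hj | hj
      · have hj' := Finset.mem_sdiff.1 hj
        have hlt : orderKey S T j < orderKey S T k := by
          have := j.2
          simp only [orderKey, hj'.1, hj'.2, hkS, hk, if_true, if_false]
          omega
        simp [hlt]
      · simp [(Finset.mem_filter.1 hj).2]
    · exact Finset.disjoint_left.2 fun j hj hj' =>
        (Finset.mem_sdiff.1 hj).2 (Finset.mem_filter.1 hj').1

theorem lower_decreasing (hx : 0 < x) (hx1 : x ≤ 1) (hp : 0 ≤ p) (h : x + p = 1)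
    {S T : Finset (Fin M)} (hT : T ⊆ S) (hTS : ∀ a ∈ S \ T, ∀ b ∈ T, a < b) :
    (∑ k ∈ T, p * x ^ (T.filter fun j => k < j).card * x ^ above S k) +
      (x ^ S.card - x ^ M) ≤ lower x p (T ∪ Sᶜ) (orderKey S T) := by
  refine le_trans (add_le_add ?_ le_rfl) (lower_split hx hx1 hp h hT)
  refine Finset.sum_le_sum fun k hk => ?_
  rw [mul_assoc, ← pow_add]
  refine mul_le_mul_of_nonneg_left (pow_le_pow_of_le_one hx.le hx1 ?_) hp
  refine card_le_add_above fun j hj => ?_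
  simp only [Finset.mem_filter, Finset.mem_univ, true_and, Finset.mem_union,
    Finset.mem_compl] at hj
  have hkM := k.2
  have hkS := hT hk
  by_cases hjS : j ∈ S
  · left
    rw [Finset.mem_filter]
    rcases hj with ⟨hj | hj, hlt⟩ | hj
    · refine ⟨hj, ?_⟩
      have := j.2
      simp only [orderKey, hjS, hj, hkS, hk, if_true] at hlt
      rw [Fin.lt_def]; omega
    · exact absurd hjS hj
    · refine ⟨?_, hj⟩
      by_contra hcon
      exact lt_asymm hj (hTS j (Finset.mem_sdiff.2 ⟨hjS, hcon⟩) k hk)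
  · right
    refine ⟨hjS, ?_⟩
    rcases hj with ⟨-, hlt⟩ | hj
    · exact lt_of_orderKey_lt hjS hlt
    · exact hj

/-- The weight `x ^ above S k` grows with `k`, so the weights on the top part dominate those below
it. -/
theorem exists_separating (hx : 0 < x) (hx1 : x ≤ 1) {S T : Finset (Fin M)}
    (hTS : ∀ a ∈ S \ T, ∀ b ∈ T, a < b) (hne : T.Nonempty) :
    ∃ c : ℝ, 0 ≤ c ∧ (∀ a ∈ S \ T, x ^ above S a ≤ c) ∧ ∀ b ∈ T, c ≤ x ^ above S b :=
  ⟨x ^ above S (T.min' hne), by positivity,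
    fun a ha => pow_le_pow_of_le_one hx.le hx1
      (above_anti S (hTS a ha _ (Finset.min'_mem _ _)).le),
    fun b hb => pow_le_pow_of_le_one hx.le hx1 (above_anti S (Finset.min'_le _ _ hb))⟩

end Orders

/-! ### Comparing the rule with the benchmark, for each size of `S`. -/

section Ratio

variable {M : ℕ} {x p Γ : ℝ}

theorem card_mul_le_log (hx : 0 < x) (h : x + p = 1) (s : ℕ) :
    s * p ≤ Real.log (1 / x ^ s) := by
  have h1 : Real.log x ≤ x - 1 := Real.log_le_sub_one_of_pos hx
  rw [one_div, Real.log_inv, Real.log_pow]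
  have : (0 : ℝ) ≤ s := by positivity
  nlinarith

/-- This is `t p (1 - p) ^ (t - 1) ≈ 1/e` for `t ≈ 1/p`; the factor `x` pays for rounding `1/p`
down. -/
theorem floor_bounds (hx : 0 < x) (hp : 0 < p) (h : x + p = 1) :
    1 ≤ ⌊1 / p⌋₊ ∧ ⌊1 / p⌋₊ * p ≤ 1 ∧
      x * (1 / Real.exp 1) ≤ ⌊1 / p⌋₊ * p * x ^ (⌊1 / p⌋₊ - 1) := by
  have h1 : 1 ≤ ⌊1 / p⌋₊ := by
    rw [Nat.one_le_floor_iff, le_div_iff₀ hp]; linarith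
  have h2 : (⌊1 / p⌋₊ : ℝ) * p ≤ 1 := by
    rw [← le_div_iff₀ hp]; exact Nat.floor_le (by positivity)
  have h3 : x ≤ (⌊1 / p⌋₊ : ℝ) * p := by
    have := Nat.lt_floor_add_one (1 / p)
    rw [div_lt_iff₀ hp] at this
    linarith
  refine ⟨h1, h2, mul_le_mul h3 ?_ (by positivity) (by positivity)⟩
  generalize ⌊1 / p⌋₊ = t at *
  rw [one_div, ← Real.exp_neg, ← Real.le_log_iff_exp_le (by positivity), Real.log_pow,
    Nat.cast_sub h1, Nat.cast_one]
  have h4 := Real.one_sub_inv_le_log_of_pos hx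
  have h5 : (0 : ℝ) ≤ (t : ℝ) - 1 := by
    have : (1 : ℝ) ≤ t := by exact_mod_cast h1
    linarith
  have h6 : ((t : ℝ) - 1) * p ≤ x := by linarith
  have h7 : (1 - x⁻¹) = -(p / x) := by field_simp; linarith
  rw [h7] at h4
  have h8 : ((t : ℝ) - 1) * (p / x) ≤ 1 := by
    rw [← mul_div_assoc, div_le_one hx]; exact h6
  nlinarith [mul_le_mul_of_nonneg_left h4 h5]

theorem pow_card_pred (hx : 0 < x) {s : ℕ} (hs : 1 ≤ s) : x ^ (s - 1) = x ^ s / x := by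
  rw [eq_div_iff hx.ne', ← pow_succ, Nat.sub_add_cancel hs]

/-- Few boxes in `S`. -/
theorem upper_le_of_card_lt (hx : 0 < x) (hx1 : x ≤ 1) (hp : 0 ≤ p) (h : x + p = 1)
    (hΓ : 1 / 2 ≤ Γ) {S : Finset (Fin M)} (hs : S.card * p ≤ 1) :
    upper x p S (orderKey S ∅) ≤
      x ^ M + Γ / x ^ 2 * (lower x p (S ∪ Sᶜ) (orderKey S ∅) + x ^ M) := by
  have h1 := upper_increasing hx hx1 hp S
  have h2 := lower_increasing hx hx1 hp h (subset_refl S) (by simp)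
  set H := ∑ k ∈ S, x ^ above S k
  have hH : H ≤ S.card := by
    refine (Finset.sum_le_card_nsmul _ _ 1 fun k _ => pow_le_one₀ hx.le hx1).trans ?_
    simp
  set u := p * x ^ (S.card - 1) * H with hu
  have hu0 : 0 ≤ u := mul_nonneg (by positivity) (Finset.sum_nonneg fun k _ => by positivity)
  have hq : 0 < x ^ S.card := by positivity
  have huq : u * x ≤ x ^ S.card := by
    rcases Nat.eq_zero_or_pos S.card with h0 | h0
    · have : H ≤ 0 := by simpa [h0] using hH
      have : u ≤ 0 := mul_nonpos_of_nonneg_of_nonpos (by positivity) this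
      nlinarith
    · rw [hu, pow_card_pred hx h0]
      calc p * (x ^ S.card / x) * H * x = x ^ S.card * (p * H) := by field_simp
        _ ≤ x ^ S.card * (p * S.card) := by gcongr
        _ ≤ x ^ S.card * 1 := by gcongr; linarith
        _ = _ := mul_one _
  -- Up to the factor `x`, `u` is at most `x ^ |S|`, so the ratio `u / (u + x ^ |S|)` is about `1/2`
  -- or less.
  have key : u ≤ Γ / x ^ 2 * (u + x ^ S.card) := by
    rw [div_mul_eq_mul_div, le_div_iff₀ (by positivity)]
    have : u * x ^ 2 ≤ u := mul_le_of_le_one_right hu0 (pow_le_one₀ hx.le hx1)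
    have : u * x ^ 2 ≤ x ^ S.card := by nlinarith
    nlinarith
  have : Γ / x ^ 2 * (u + x ^ S.card) ≤
      Γ / x ^ 2 * (lower x p (S ∪ Sᶜ) (orderKey S ∅) + x ^ M) := by
    exact mul_le_mul_of_nonneg_left (by linarith) (div_nonneg (by linarith) (by positivity))
  linarith

theorem upper_le_of_increasing (hx : 0 < x) (hx1 : x ≤ 1) (hp : 0 ≤ p) (h : x + p = 1)
    (hΓ : 0 ≤ Γ) {S T : Finset (Fin M)} (hT : T ⊆ S) (hTS : ∀ a ∈ S \ T, ∀ b ∈ T, a < b)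
    (hne : T.Nonempty) (ht : x * (1 / Real.exp 1) ≤ T.card * p * x ^ (T.card - 1))
    (hq : x ^ S.card * Real.log (1 / x ^ S.card) ≤ Γ * (x ^ S.card + 1 / Real.exp 1)) :
    upper x p S (orderKey S ∅) ≤
      x ^ M + Γ / x ^ 2 * (lower x p (T ∪ Sᶜ) (orderKey S ∅) + x ^ M) := by
  have h1 := upper_increasing hx hx1 hp S
  have h2 := lower_increasing hx hx1 hp h hT hTS
  obtain ⟨c, hc0, hc1, hc2⟩ := exists_separating hx hx1 hTS hne
  have hS : ∑ k ∈ S, x ^ above S k = ∑ k ∈ S \ T, x ^ above S k + ∑ k ∈ T, x ^ above S k :=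
    (Finset.sum_sdiff hT).symm
  have hB : ∑ k ∈ S \ T, x ^ above S k ≤ (S.card - T.card : ℝ) * c := by
    refine (Finset.sum_le_card_nsmul _ _ c hc1).trans_eq ?_
    rw [Finset.card_sdiff_of_subset hT, nsmul_eq_mul, Nat.cast_sub (Finset.card_le_card hT)]
  have hcT : T.card * c ≤ ∑ k ∈ T, x ^ above S k := by
    simpa using Finset.card_nsmul_le_sum _ _ c hc2
  have hT1 : ∑ k ∈ T, x ^ above S k ≤ T.card := by
    refine (Finset.sum_le_card_nsmul _ _ 1 fun k _ => pow_le_one₀ hx.le hx1).trans ?_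
    simp
  have htpos : (0 : ℝ) < T.card := by exact_mod_cast Finset.card_pos.2 hne
  have hst : (T.card : ℝ) ≤ S.card := by exact_mod_cast Finset.card_le_card hT
  have hs1 : 1 ≤ S.card := (Finset.card_pos.2 hne).trans_le (Finset.card_le_card hT)
  rw [hS] at h1
  set HT := ∑ k ∈ T, x ^ above S k
  set q := x ^ S.card
  have hq0 : 0 < q := by positivity
  have he : 0 < 1 / Real.exp 1 := by positivity
  -- `d` is the mean weight on `T`; it bounds every weight on `S \ T` and is at most `1`.
  obtain ⟨d, hd⟩ : ∃ d, HT = T.card * d := ⟨HT / T.card, by field_simp⟩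
  rw [hd] at h1 h2 hcT hT1
  have hcd : c ≤ d := le_of_mul_le_mul_left hcT htpos
  have hd1 : d ≤ 1 := by
    by_contra hcon
    push Not at hcon
    nlinarith
  have hd0 : 0 ≤ d := hc0.trans hcd
  have hA : ∑ k ∈ S \ T, x ^ above S k + T.card * d ≤ S.card * d := by
    nlinarith [mul_le_mul_of_nonneg_left hcd (sub_nonneg.2 hst)]
  have hlog := card_mul_le_log hx h S.card
  have h3 : p * x ^ (S.card - 1) * (∑ k ∈ S \ T, x ^ above S k + T.card * d) ≤
      Γ / x ^ 2 * (x * (1 / Real.exp 1) * d + q) := by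
    calc p * x ^ (S.card - 1) * (∑ k ∈ S \ T, x ^ above S k + T.card * d)
        ≤ p * x ^ (S.card - 1) * (S.card * d) := by gcongr
      _ = d / x * (q * (S.card * p)) := by rw [pow_card_pred hx hs1]; ring
      _ ≤ d / x * (q * Real.log (1 / q)) := by gcongr
      _ ≤ d / x * (Γ * (q + 1 / Real.exp 1)) := by gcongr
      _ = Γ / x ^ 2 * (x * (1 / Real.exp 1) * d + x * d * q) := by field_simp; ring
      _ ≤ _ := by
        gcongr
        have : x * d ≤ 1 := mul_le_one₀ hx1 hd0 hd1
        exact mul_le_of_le_one_left hq0.le this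
  have h4 : x * (1 / Real.exp 1) * d + q ≤ lower x p (T ∪ Sᶜ) (orderKey S ∅) + x ^ M := by
    have := mul_le_mul_of_nonneg_right ht hd0
    linarith
  have h5 : Γ / x ^ 2 * (x * (1 / Real.exp 1) * d + q) ≤
      Γ / x ^ 2 * (lower x p (T ∪ Sᶜ) (orderKey S ∅) + x ^ M) := by
    gcongr
  linarith

theorem upper_le_of_decreasing (hx : 0 < x) (hx1 : x < 1) (hp : 0 ≤ p) (h : x + p = 1)
    (hΓ : 0 ≤ Γ) {S T : Finset (Fin M)} (hT : T ⊆ S) (hTS : ∀ a ∈ S \ T, ∀ b ∈ T, a < b)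
    (hne : T.Nonempty) {b : ℕ} (hb : S.card = b + T.card)
    (hq : x ^ S.card * Real.log (1 / x ^ b) + x ^ b - x ^ S.card ≤
      Γ * (x ^ S.card + 1 - x ^ S.card / x ^ b)) :
    upper x p S (orderKey S T) ≤
      x ^ M + Γ / x ^ 2 * (lower x p (T ∪ Sᶜ) (orderKey S T) + x ^ M) := by
  have h1 := upper_decreasing hx hx1.le hp hT hTS
  have h2 := lower_decreasing hx hx1.le hp h hT hTS
  obtain ⟨c, hc0, hc1, hc2⟩ := exists_separating hx hx1.le hTS hne
  have hB : ∑ k ∈ S \ T, x ^ above S k ≤ b * c := by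
    refine (Finset.sum_le_card_nsmul _ _ c hc1).trans_eq ?_
    rw [Finset.card_sdiff_of_subset hT, nsmul_eq_mul, hb, Nat.add_sub_cancel]
  have hW := sum_mul_pow_card_above h T
  set Y := ∑ k ∈ T, p * x ^ (T.filter fun j => k < j).card * x ^ above S k
  set w := 1 - x ^ T.card with hw
  have hw0 : 0 < w := by
    rw [hw, sub_pos]; exact pow_lt_one₀ hx.le hx1 (Finset.card_pos.2 hne).ne'
  have hYc : w * c ≤ Y := by
    rw [← hW, Finset.sum_mul]
    exact Finset.sum_le_sum fun k hk => mul_le_mul_of_nonneg_left (hc2 k hk) (by positivity)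
  have hYw : Y ≤ w := by
    rw [← hW]
    exact Finset.sum_le_sum fun k _ =>
      mul_le_of_le_one_right (by positivity) (pow_le_one₀ hx.le hx1.le)
  -- Here `d` is the mean weight on `T` with respect to the law of its largest non-zero box.
  obtain ⟨d, hd⟩ : ∃ d, Y = w * d := ⟨Y / w, by field_simp⟩
  rw [hd] at hYc hYw h1 h2
  have hcd : c ≤ d := le_of_mul_le_mul_left hYc hw0
  have hd0 : 0 ≤ d := hc0.trans hcd
  have hd1 : d ≤ 1 := by
    by_contra hcon
    push Not at hcon
    nlinarith
  have hs1 : 1 ≤ S.card := (Finset.card_pos.2 hne).trans_le (Finset.card_le_card hT)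
  have hlog := card_mul_le_log hx h b
  have hsb : S.card - T.card = b := by omega
  have hqb : x ^ S.card = x ^ b * x ^ T.card := by rw [hb, pow_add]
  have hdiv : x ^ S.card / x ^ b = x ^ T.card := by rw [hqb]; field_simp
  rw [hdiv] at hq
  rw [hsb] at h1
  have hrw : x ^ b * w = x ^ b - x ^ S.card := by rw [hw, hqb]; ring
  set q := x ^ S.card
  have hq0 : 0 < q := by positivity
  have hrw0 : 0 ≤ x ^ b * w := by positivity
  have h3 : p * x ^ (S.card - 1) * (∑ k ∈ S \ T, x ^ above S k) + x ^ b * (w * d) ≤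
      Γ / x ^ 2 * (w * d + q) := by
    calc p * x ^ (S.card - 1) * (∑ k ∈ S \ T, x ^ above S k) + x ^ b * (w * d)
        ≤ p * x ^ (S.card - 1) * (b * d) + x ^ b * (w * d) := by
          gcongr
          exact hB.trans (by gcongr)
      _ = d / x * (q * (b * p)) + d * (x ^ b * w) := by rw [pow_card_pred hx hs1]; ring
      _ ≤ d / x * (q * Real.log (1 / x ^ b)) + d / x * (x ^ b * w) := by
          gcongr
          rw [le_div_iff₀ hx]
          exact mul_le_of_le_one_right hd0 hx1.le
      _ = d / x * (q * Real.log (1 / x ^ b) + x ^ b - q) := by rw [hrw]; ring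
      _ ≤ d / x * (Γ * (q + 1 - x ^ T.card)) := by gcongr
      _ = Γ / x ^ 2 * (x * (w * d) + x * d * q) := by rw [hw]; field_simp; ring
      _ ≤ _ := by
        have h5 : x * d ≤ 1 := mul_le_one₀ hx1.le hd0 hd1
        have h6 : x * (w * d) ≤ w * d := mul_le_of_le_one_left (by positivity) hx1.le
        have h7 : x * d * q ≤ q := mul_le_of_le_one_left hq0.le h5
        gcongr
  have h5 : Γ / x ^ 2 * (w * d + q) ≤
      Γ / x ^ 2 * (lower x p (T ∪ Sᶜ) (orderKey S T) + x ^ M) := by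
    exact mul_le_mul_of_nonneg_left (by linarith) (div_nonneg (by linarith) (by positivity))
  linarith

/-- For every set `S` there is an order with a bad performance ratio. -/
theorem exists_order {lam ρ : ℝ} (hx : 0 < x) (hp : 0 < p) (h : x + p = 1)
    (hΓ : 1 / 2 ≤ Γ) (hlam : ∀ q, lam ≤ q → q * Real.log (1 / q) ≤ Γ * (q + 1 / Real.exp 1))
    (hρ : lam < ρ) (hρq : ∀ q, 0 < q → q ≤ lam →
      q * Real.log (1 / ρ) + ρ - q ≤ Γ * (q + 1 - q / ρ))
    {b : ℕ} (hb : x ^ b = ρ) (S : Finset (Fin M)) :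
    ∃ D G : Finset (Fin M), upper x p S (orderKey S D) ≤
      x ^ M + Γ / x ^ 2 * (lower x p G (orderKey S D) + x ^ M) := by
  have hx1 : x < 1 := by linarith
  obtain ⟨ht1, ht2, ht3⟩ := floor_bounds hx hp h
  rcases le_total lam (x ^ S.card) with hq | hq
  · rcases le_total ⌊1 / p⌋₊ S.card with hs | hs
    · obtain ⟨T, hT, hTc, hTS⟩ := exists_top_subset S hs
      exact ⟨∅, _, upper_le_of_increasing hx hx1.le hp.le h (by linarith) hT hTS
        (Finset.card_pos.1 (by omega)) (by rwa [hTc]) (hlam _ hq)⟩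
    · refine ⟨∅, _, upper_le_of_card_lt hx hx1.le hp.le h hΓ (le_trans ?_ ht2)⟩
      gcongr
  · have hbs : b < S.card := by
      by_contra hcon
      have := pow_le_pow_of_le_one hx.le hx1.le (not_lt.1 hcon)
      linarith
    obtain ⟨T, hT, hTc, hTS⟩ := exists_top_subset S (Nat.sub_le S.card b)
    refine ⟨T, _, upper_le_of_decreasing hx hx1 hp.le h (by linarith) hT hTS
      (Finset.card_pos.1 (by omega)) (b := b) (by omega) ?_⟩
    rw [hb]
    exact hρq _ (by positivity) hq

/-- A bound that holds for every order: accept the first of the largest `⌊1 / p⌋₊` values. -/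
theorem exists_lower_ge (hx : 0 < x) (hp : 0 < p) (h : x + p = 1) (hM : ⌊1 / p⌋₊ ≤ M)
    (key : Fin M → ℕ) : ∃ G, x * (1 / Real.exp 1) ≤ lower x p G key := by
  obtain ⟨ht1, ht2, ht3⟩ := floor_bounds hx hp h
  obtain ⟨T, -, hTc, hTS⟩ := exists_top_subset (Finset.univ : Finset (Fin M))
    (t := ⌊1 / p⌋₊) (by simpa using hM)
  refine ⟨T, ht3.trans ?_⟩
  rw [lower, ← hTc, mul_assoc, ← nsmul_eq_mul]
  refine Finset.card_nsmul_le_sum _ _ _ fun k hk => ?_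
  refine mul_le_mul_of_nonneg_left (pow_le_pow_of_le_one hx.le (by linarith) ?_) hp.le
  rw [← Finset.card_erase_of_mem hk]
  refine Finset.card_le_card fun j hj => ?_
  simp only [Finset.mem_filter, Finset.mem_univ, true_and] at hj
  rw [Finset.mem_erase]
  rcases hj with hj | hj
  · exact ⟨by rintro rfl; exact lt_irrefl _ hj.2, hj.1⟩
  · refine ⟨hj.ne', ?_⟩
    by_contra hcon
    exact lt_asymm hj (hTS j (by simp [hcon]) k hk)

end Ratio

/-! ### The hard instance and the choice of arrival times. -/

/-- Box `b < M` contains `b + 1` with probability `p` and `0` otherwise; the others are empty. -/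
noncomputable def hardInstance (x p : ℝ≥0) (h : x + p = 1) (M n : ℕ) :
    Fin n → ProbabilityMeasure ℝ≥0 :=
  fun b => twoPoint x p h (if (b : ℕ) < M then b + 1 else 0)

section HardInstance

variable {x p : ℝ≥0} (h : x + p = 1) {M n : ℕ}

/-- The maximum is `0` only when all boxes are, with probability `x ^ M`; any other value `k + 1`
requires box `k` to be non-zero, with probability `p`. -/
theorem smallMaxAtoms_hardInstance (hMn : M ≤ n) {ε : ℝ≥0} (hp : p ≤ ε) (hx : x ^ M ≤ ε) :
    SmallMaxAtoms ε (hardInstance x p h M n) := by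
  intro y
  set a : Fin n → ℝ≥0 := fun b => if (b : ℕ) < M then b + 1 else 0 with ha_def
  have he : Function.Injective (Fin.castLE hMn) := Fin.castLE_injective hMn
  have ha : ∀ k, a (Fin.castLE hMn k) = k + 1 := fun k => by simp [ha_def]
  have hr : ∀ i : Fin n, (i : ℕ) < M → i ∈ range (Fin.castLE hMn) :=
    fun i hi => ⟨⟨i, hi⟩, rfl⟩
  have ha0 : ∀ i ∉ range (Fin.castLE hMn), a i = 0 := fun i hi => by
    have : ¬ (i : ℕ) < M := fun hh => hi (hr i hh)
    simp [ha_def, this]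
  change (Measure.pi fun i => (twoPoint x p h (a i) : Measure ℝ≥0)) _ ≤ _
  by_cases hy : y = 0
  · refine le_trans (measure_mono (t := {0}) fun v hv => ?_) ?_
    · have hv' : Finset.univ.sup v = y := hv
      funext i
      exact le_antisymm ((Finset.le_sup (Finset.mem_univ i)).trans_eq (hv'.trans hy)) (zero_le)
    · rw [pi_zero h he ha ha0]
      exact_mod_cast hx
  · have hmem : ∀ v : Fin n → ℝ≥0, (∀ i, v i = 0 ∨ v i = a i) → Finset.univ.sup v = y →
        ∃ k : Fin M, (k + 1 : ℝ≥0) = y ∧ v ∈ box a (Fin.castLE hMn) k ∅ := by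
      intro v hv hsup
      have hne : (Finset.univ : Finset (Fin n)).Nonempty := by
        rw [Finset.nonempty_iff_ne_empty]
        intro hempty
        rw [hempty, Finset.sup_empty] at hsup
        exact hy hsup.symm
      obtain ⟨i, -, hi⟩ := Finset.exists_mem_eq_sup _ hne v
      rw [hsup] at hi
      have hai : v i = a i := (hv i).resolve_left (hi ▸ hy)
      by_cases hir : i ∈ range (Fin.castLE hMn)
      · obtain ⟨k, rfl⟩ := hir
        refine ⟨k, by rw [hi, hai, ha], fun j _ => ?_⟩
        by_cases hj : j = Fin.castLE hMn k
        · subst hj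
          simpa using hai
        · simpa [hj] using hv j
      · exact absurd (hi.trans (hai.trans (ha0 i hir))) hy
    by_cases hk : ∃ k : Fin M, (k + 1 : ℝ≥0) = y
    · obtain ⟨k, hk⟩ := hk
      refine le_trans (measure_mono_ae (t := box a (Fin.castLE hMn) k ∅) ?_) ?_
      · filter_upwards [ae_mem_pair h] with v hv hsup
        obtain ⟨m, hm, hvm⟩ := hmem v hv hsup
        have : m = k := by
          rw [← hk] at hm
          have h2 : (m : ℝ≥0) = k := by simpa using hm
          exact Fin.ext (by exact_mod_cast h2)
        exact this ▸ hvm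
      · rw [pi_box h he ha (by simp)]
        simpa using hp
    · refine le_trans (measure_mono_ae (t := ∅) ?_) (by simp)
      filter_upwards [ae_mem_pair h] with v hv hsup
      obtain ⟨m, hm, -⟩ := hmem v hv hsup
      exact hk ⟨m, hm⟩

/-- Among enough times there are `M` at which a rule treats the first non-zero value alike. -/
theorem exists_stationary_times (hn : 2 ^ M * M ≤ n) (R : OnlineRule n) :
    ∃ (S : Finset (Fin M)) (T : Finset (Fin n)), T.card = M ∧ ∀ t ∈ T, ∀ k : Fin M,
      (fun j : Iic t => if (j : Fin n) = t then (k + 1 : ℝ≥0) else 0) ∈ R.acc t ↔ k ∈ S := by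
  classical
  obtain ⟨S, hS⟩ := Fintype.exists_le_card_fiber_of_mul_le_card (n := M)
    (fun t : Fin n => Finset.univ.filter fun k : Fin M =>
      (fun j : Iic t => if (j : Fin n) = t then (k + 1 : ℝ≥0) else 0) ∈ R.acc t)
    (by simpa using hn)
  obtain ⟨T, hT, hTc⟩ := Finset.exists_subset_card_eq hS
  refine ⟨S, T, hTc, fun t ht k => ?_⟩
  have := (Finset.mem_filter.1 (hT ht)).2
  rw [← this]
  simp

/-- The boxes, sorted by `key`, are put at the times of `T` in increasing order; the empty boxes
fill the remaining times arbitrarily. -/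
theorem exists_arrival_times (hMn : M ≤ n) {T : Finset (Fin n)} (hT : T.card = M)
    {key : Fin M → ℕ} (hkey : Function.Injective key) :
    ∃ (e : Fin M → Fin n) (π : Equiv.Perm (Fin n)), Function.Injective e ∧ (∀ k, e k ∈ T) ∧
      (∀ j k, e j < e k ↔ key j < key k) ∧ ∀ k, π (e k) = Fin.castLE hMn k := by
  classical
  set σ := Tuple.sort key
  have hσ : StrictMono (key ∘ σ) :=
    (Tuple.monotone_sort key).strictMono_of_injective (hkey.comp σ.injective)
  set e : Fin M → Fin n := fun k => T.orderEmbOfFin hT (σ.symm k) with he_def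
  have he : Function.Injective e := (T.orderEmbOfFin hT).injective.comp σ.symm.injective
  refine ⟨e, ((Equiv.ofInjective e he).symm.trans
    (Equiv.ofInjective _ (Fin.castLE_injective hMn))).extendSubtype, he,
    fun k => Finset.orderEmbOfFin_mem _ _ _, fun j k => ?_, fun k => ?_⟩
  · rw [he_def, OrderEmbedding.lt_iff_lt, ← hσ.lt_iff_lt]
    simp
  · rw [Equiv.extendSubtype_apply_of_mem _ _ (mem_range_self k)]
    have : (⟨e k, mem_range_self k⟩ : range e) = Equiv.ofInjective e he k := rfl
    rw [this, Equiv.trans_apply, Equiv.symm_apply_apply]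
    rfl

theorem exists_bad_order (hMn : M ≤ n) (hn : 2 ^ M * M ≤ n) (R : OnlineRule n) :
    ∃ S : Finset (Fin M), ∀ key : Fin M → ℕ, Function.Injective key →
      (∀ k ∉ S, ∀ j, key k < key j → j < k) → ∃ π : Equiv.Perm (Fin n),
        R.winProb (hardInstance x p h M n) π ≤ ENNReal.ofReal (upper x p S key) ∧
        ∀ G, ENNReal.ofReal (lower x p G key) ≤ opt (hardInstance x p h M n) π := by
  obtain ⟨S, T, hT, hS⟩ := exists_stationary_times hn R
  refine ⟨S, fun key hkey hdec => ?_⟩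
  obtain ⟨e, π, he, heT, hlt, hπ⟩ := exists_arrival_times hMn hT hkey
  set a : Fin n → ℝ≥0 := fun i => if (π i : ℕ) < M then (π i : ℕ) + 1 else 0 with ha_def
  have ha : ∀ k, a (e k) = k + 1 := fun k => by simp [ha_def, hπ]
  have ha0 : ∀ i ∉ range e, a i = 0 := fun i hi => by
    have : ¬ (π i : ℕ) < M := fun hh => hi ⟨⟨π i, hh⟩, π.injective (by rw [hπ]; rfl)⟩
    simp [ha_def, this]
  have hF : ∀ i, hardInstance x p h M n (π i) = twoPoint x p h (a i) := fun i => rfl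
  refine ⟨π, ?_, fun G => ?_⟩
  · refine (winProb_le h he ha ha0 R _ π hF S (fun k => hS _ (heT k) k)
      (fun k hk j hj => hdec k hk j ((hlt _ _).1 hj))).trans_eq ?_
    rw [← ENNReal.ofReal_coe_nnreal, upper]
    simp only [hlt]
    push_cast
    rfl
  · refine le_trans (le_of_eq ?_) (le_opt h he ha ha0 _ π hF G)
    rw [← ENNReal.ofReal_coe_nnreal, lower]
    simp only [hlt]
    push_cast
    rfl

end HardInstance

/-! ### The limit `p → 0`, `x ^ M → 0`, and the conclusion. -/

theorem gap_le_add {Γ lam ρ : ℝ} (hΓ : 1 / 2 ≤ Γ)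
    (hlam : ∀ q, lam ≤ q → q * Real.log (1 / q) ≤ Γ * (q + 1 / Real.exp 1))
    (hρ0 : 0 < ρ) (hρ1 : ρ < 1) (hρ : lam < ρ) (hρq : ∀ q, 0 < q → q ≤ lam →
      q * Real.log (1 / ρ) + ρ - q ≤ Γ * (q + 1 - q / ρ))
    (ALG : Algorithm) {ε : ℝ≥0} (hε : 0 < ε) {η : ℝ} (hη : 0 < η) :
    gap ε ALG ≤ ENNReal.ofReal (Γ + η) := by
  have hε' : (0 : ℝ) < ε := hε
  -- Choosing `x = ρ ^ (1/b)` makes `x ^ b = ρ` exact while `x → 1`.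
  have hlim : Filter.Tendsto (fun b : ℕ => ρ ^ (1 / (b : ℝ))) Filter.atTop (nhds 1) := by
    have := (Real.continuous_const_rpow hρ0.ne').tendsto 0
    rw [Real.rpow_zero] at this
    exact this.comp tendsto_one_div_atTop_nhds_zero_nat
  have hlim2 : Filter.Tendsto (fun b : ℕ => Γ / (ρ ^ (1 / (b : ℝ))) ^ 2) Filter.atTop
      (nhds Γ) := by
    have := (tendsto_const_nhds (x := Γ)).div (hlim.pow 2) (by norm_num)
    rwa [one_pow, div_one] at this
  obtain ⟨b, hb1, hb2, hb3, hb4⟩ :=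
    ((hlim.eventually (lt_mem_nhds (show (0.7 : ℝ) < 1 by norm_num))).and
    ((hlim.eventually (lt_mem_nhds (show 1 - (ε : ℝ) < 1 by linarith))).and
    ((hlim2.eventually (gt_mem_nhds (show Γ < Γ + η / 2 by linarith))).and
    (Filter.eventually_gt_atTop 0)))).exists
  obtain ⟨x, hx⟩ : ∃ x : ℝ, x = ρ ^ (1 / (b : ℝ)) := ⟨_, rfl⟩
  rw [← hx] at hb1 hb2 hb3
  have hxb : x ^ b = ρ := by
    rw [hx, one_div, Real.rpow_inv_natCast_pow hρ0.le hb4.ne']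
  have hx0 : 0 < x := by linarith
  have hx1 : x < 1 := by rw [hx]; exact Real.rpow_lt_one hρ0.le hρ1 (by positivity)
  set g := Γ / x ^ 2 with hg
  have hg0 : 0 < g := div_pos (by linarith) (by positivity)
  have hpow := tendsto_pow_atTop_nhds_zero_of_lt_one hx0.le hx1
  obtain ⟨M, hM1, hM2, hM3, hM4⟩ := ((hpow.eventually (gt_mem_nhds hε')).and
    ((hpow.eventually (gt_mem_nhds (show 0 < η / 8 / (1 + g) by positivity))).and
    ((Filter.eventually_ge_atTop ⌊1 / (1 - x)⌋₊).and
    (Filter.eventually_gt_atTop 0)))).exists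
  rw [lt_div_iff₀ (by positivity)] at hM2
  lift x to ℝ≥0 using hx0.le
  obtain ⟨p, hp⟩ : ∃ p : ℝ≥0, (p : ℝ) = 1 - x := ⟨⟨1 - x, by linarith⟩, rfl⟩
  have hxp : x + p = 1 := by
    rw [← NNReal.coe_inj]; push_cast; linarith
  have hxp' : (x : ℝ) + p = 1 := by linarith
  have hMn : M ≤ 2 ^ M * M := Nat.le_mul_of_pos_left _ (by positivity)
  obtain ⟨S, hS⟩ := exists_bad_order hxp hMn le_rfl
    (ALG (2 ^ M * M) (hardInstance x p hxp M (2 ^ M * M)))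
  have hp0 : (0 : ℝ) < p := by linarith
  obtain ⟨D, G₁, hG₁⟩ := exists_order hx0 hp0 hxp' hΓ hlam hρ hρq hxb S
  obtain ⟨G₂, hG₂⟩ := exists_lower_ge hx0 hp0 hxp' (by rw [hp]; exact hM3) (orderKey S D)
  obtain ⟨π, hπ1, hπ2⟩ := hS (orderKey S D) (orderKey_injective S D)
    fun k hk j hj => lt_of_orderKey_lt hk hj
  have hatoms : SmallMaxAtoms ε (hardInstance x p hxp M (2 ^ M * M)) := by
    refine smallMaxAtoms_hardInstance hxp hMn ?_ ?_
    · rw [← NNReal.coe_le_coe]; linarith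
    · rw [← NNReal.coe_le_coe]; push_cast; exact hM1.le
  refine (iInf_le _ (2 ^ M * M)).trans ((iInf_le _ (by positivity)).trans ((iInf_le _ _).trans
    ((iInf_le _ hatoms).trans ((iInf_le _ π).trans ?_))))
  refine ENNReal.div_le_of_le_mul ?_
  set l := max (lower x p G₁ (orderKey S D)) (lower x p G₂ (orderKey S D)) with hl
  have hl1 : ENNReal.ofReal l ≤ opt (hardInstance x p hxp M (2 ^ M * M)) π := by
    rw [hl, ENNReal.ofReal_max]
    exact max_le (hπ2 _) (hπ2 _)
  -- A benchmark bounded away from zero, from `x > 0.7` and `1/e`, turns the additive error `(1 + g)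
  -- x ^ M < η / 8` into at most `(η / 2) l`.
  have hl2 : 1 / 4 ≤ l := by
    have := inv_exp_one_bounds.1
    refine le_trans ?_ (le_max_right _ _)
    nlinarith
  have hl3 : lower x p G₁ (orderKey S D) ≤ l := le_max_left _ _
  have hup : upper x p S (orderKey S D) ≤ (Γ + η) * l := by
    have h1 : g * (lower x p G₁ (orderKey S D) + (x : ℝ) ^ M) ≤ g * (l + (x : ℝ) ^ M) :=
      mul_le_mul_of_nonneg_left (by linarith) hg0.le
    nlinarith
  calc _ ≤ ENNReal.ofReal (upper x p S (orderKey S D)) := hπ1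
    _ ≤ ENNReal.ofReal ((Γ + η) * l) := ENNReal.ofReal_le_ofReal hup
    _ = ENNReal.ofReal (Γ + η) * ENNReal.ofReal l := ENNReal.ofReal_mul (by linarith)
    _ ≤ _ := by gcongr

end IdentityBlind

theorem theorem4 :
    (∃! lam : ℝ, IdentityBlind.IsLam lam) ∧
    ∀ lam : ℝ, IdentityBlind.IsLam lam →
      |lam - 0.245| < 0.0005 ∧
      |IdentityBlind.Gam lam - 0.562| < 0.0005 ∧
      ∀ (ALG : IdentityBlind.Algorithm) (ε : ℝ≥0), 0 < ε →
        IdentityBlind.gap ε ALG ≤ ENNReal.ofReal (IdentityBlind.Gam lam) := by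
  obtain ⟨lam, hlam, hl1, hl2, hG1, hG2, hG3, ρ, hρ, hρ1, hlog, hN⟩ := IdentityBlind.exists_isLam
  have huniq : ∀ a, IdentityBlind.IsLam a → a = lam := fun a ha =>
    le_antisymm (not_lt.1 (hlam.not_lt ha)) (not_lt.1 (ha.not_lt hlam))
  refine ⟨⟨lam, hlam, huniq⟩, fun a ha => ?_⟩
  rw [huniq a ha]
  have hl0 : 0 < lam := hlam.1
  have hρ0 : 0 < ρ := hl0.trans hρ
  refine ⟨by rw [abs_lt]; constructor <;> linarith, by rw [abs_lt]; constructor <;> linarith,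
    fun ALG ε hε => ENNReal.le_of_forall_pos_le_add fun η hη _ => ?_⟩
  rw [← ENNReal.ofReal_coe_nnreal (p := η), ← ENNReal.ofReal_add (by linarith) η.coe_nonneg]
  refine IdentityBlind.gap_le_add (by linarith)
    (fun q hq => IdentityBlind.mul_log_le_Gam_mul hl0 hq hG3) hρ0 hρ1 hρ (fun q hq hql => ?_)
    ALG hε hη
  have hD : 0 < lam + 1 - lam / ρ := IdentityBlind.denom_pos hl0 hρ.le
  -- By the identity `hid`, the ratio at `lam` exceeds the one at `q` by a positive multiple of this
  -- product: the ratio is nondecreasing in `q`.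
  have hcomp : 0 ≤ (lam - q) * (Real.log (1 / ρ) - ρ) :=
    mul_nonneg (by linarith) (by linarith)
  have hid : (lam * Real.log (1 / ρ) + ρ - lam) * (q + 1 - q / ρ) -
      (q * Real.log (1 / ρ) + ρ - q) * (lam + 1 - lam / ρ) =
      (lam - q) * (Real.log (1 / ρ) - ρ) := by
    field_simp; ring
  rw [hN] at hid
  refine le_of_mul_le_mul_right ?_ hD
  linarith
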